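/- Let $\Sigma$ be a set of unary function symbols and $C$ a set of constants. Let $\mathcal K$ be any set of universally quantified clauses, each of the form $$\forall x\; f(x)\le g(x)\qquad\text{or}\qquad \forall x,y\;\bigl(y\le g(x)\rightarrow f(y)\le h(x)\bigr)$$ with $f,g,h\in\Sigma$ not necessarily distinct. Let $\mathcal T=\mathsf{SLat}\cup\mathsf{Mon}_\Sigma\cup\mathcal K$ be the theory whose models are the non-empty meet-semilattices $(S,\sqcap)$ (ordered by $x\le y\iff x\sqcap y=x$) equipped with a monotone map $f_S:S\to S$ for each $f\in\Sigma$ such that all clauses in $\mathcal K$ hold. Ground terms are built from the constants in $C$ with $\sqcap$ and the symbols in $\Sigma$, and ground atoms are of the form $s\le t$ or $s\approx t$ with $s,t$ ground terms. For $f,g\in\Sigma$ write $f\sim_{\mathcal K}g$ if $f$ and $g$ occur in a common clause of $\mathcal K$, let $\sim^*_{\mathcal K}$ be the equivalence relation on $\Sigma$ generated by $\sim_{\mathcal K}$, and for $X\subseteq\Sigma$ put $\Theta_{\mathcal K}(X)=\{g\in\Sigma\mid f\sim^*_{\mathcal K}g\text{ for some }f\in X\}$. Theorem. The theory $\mathcal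 T$ is $\le$-interpolating with $\Theta_{\mathcal K}$-sharing, that is: (1) $\mathcal T$ is convex with respect to $\le$: if $\Gamma$ is a finite conjunction of ground atoms and $\Gamma\models_{\mathcal T}\bigvee_{i=1}^m s_i\le t_i$ for ground terms $s_i,t_i$, then $\Gamma\models_{\mathcal T}s_i\le t_i$ for some $i\in\{1,\dots,m\}$; and (2) for all finite conjunctions $A$, $B$ of ground atoms, every constant $a$ occurring in $A$ and every constant $b$ occurring in $B$, if $A\wedge B\models_{\mathcal T}a\le b$, then there is a ground term $t$ such that every constant in $t$ occurs both in $A$ and in $B$, every symbol of $\Sigma$ in $t$ belongs to $\Theta_{\mathcal K}(\Sigma_A)\cap\Theta_{\mathcal K}(\Sigma_B)$, where $\Sigma_A,\Sigma_B\subseteq\Sigma$ are the sets of function symbols of $\Sigma$ occurring in $A$ and in $B$ respectively, and $$A\wedge B\models_{\mathcal T}a\le t\quad\text{and}\quad A\wedge B\models_{\mathcal T}t\le b.$$ -/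

import Mathlib

universe u v

namespace SLO

/-- Ground terms over the signature with the (interpreted) binary symbol `⊓`, the (uninterpreted)
unary function symbols `F`, and additional constants `C`. -/
inductive GTerm (F : Type u) (C : Type v) : Type (max u v)
  | const : C → GTerm F C
  | app : F → GTerm F C → GTerm F C
  | meet : GTerm F C → GTerm F C → GTerm F C

/-- Ground atoms: `s ≤ t` and `s ≈ t`. -/
inductive GAtom (F : Type u) (C : Type v) : Type (max u v)
  | le : GTerm F C → GTerm F C → GAtom F C
  | eq : GTerm F C → GTerm F C → GAtom F C

/-- The clauses that may occur in the axiom set `K`: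
`incl f g` stands for `∀ x, f(x) ≤ g(x)`, and
`comp f g h` stands for `∀ x y, y ≤ g(x) → f(y) ≤ h(x)`. -/
inductive OpClause (F : Type u) : Type u
  | incl : F → F → OpClause F
  | comp : F → F → F → OpClause F

variable {F : Type u} {C : Type v}

/-! ### Occurrences of symbols -/

/-- The constants occurring in a term. -/
def GTerm.consts : GTerm F C → Set C
  | .const c => {c}
  | .app _ t => t.consts
  | .meet s t => s.consts ∪ t.consts

/-- The uninterpreted function symbols occurring in a term. -/
def GTerm.funs : GTerm F C → Set F
  | .const _ => ∅
  | .app f t => {f} ∪ t.funs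
  | .meet s t => s.funs ∪ t.funs

/-- The constants occurring in an atom. -/
def GAtom.consts : GAtom F C → Set C
  | .le s t => s.consts ∪ t.consts
  | .eq s t => s.consts ∪ t.consts

/-- The uninterpreted function symbols occurring in an atom. -/
def GAtom.funs : GAtom F C → Set F
  | .le s t => s.funs ∪ t.funs
  | .eq s t => s.funs ∪ t.funs

/-- The constants occurring in a finite conjunction of atoms. -/
def conjConsts (A : List (GAtom F C)) : Set C := {c | ∃ φ ∈ A, c ∈ φ.consts}

/-- The uninterpreted function symbols occurring in a finite conjunction of atoms. -/
def conjFuns (A : List (GAtom F C)) : Set F := {f | ∃ φ ∈ A, f ∈ φ.funs}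

/-- The function symbols occurring in a clause. -/
def OpClause.funs : OpClause F → Set F
  | .incl f g => {f, g}
  | .comp f g h => {f, g, h}

/-! ### Semantics -/

section Semantics

variable {S : Type*} [SemilatticeInf S]

/-- Value of a ground term in a semilattice with operators. -/
def GTerm.eval (op : F → S → S) (val : C → S) : GTerm F C → S
  | .const c => val c
  | .app f t => op f (t.eval op val)
  | .meet s t => s.eval op val ⊓ t.eval op val

/-- Truth of a ground atom in a semilattice with operators. -/
def GAtom.Holds (op : F → S → S) (val : C → S) : GAtom F C → Prop
  | .le s t => s.eval op val ≤ t.eval op val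
  | .eq s t => s.eval op val = t.eval op val

/-- Truth of (the universal closure of) a clause in a semilattice with operators. -/
def OpClause.Holds (op : F → S → S) : OpClause F → Prop
  | .incl f g => ∀ x : S, op f x ≤ op g x
  | .comp f g h => ∀ x y : S, y ≤ op g x → op f y ≤ op h x

/-- The semilattice `S` with the operators `op` is a model of `SLat ∪ Mon_F ∪ K`. -/
def IsModel (K : Set (OpClause F)) (op : F → S → S) : Prop :=
  (∀ f : F, Monotone (op f)) ∧ ∀ κ ∈ K, κ.Holds op

end Semantics

/-- `Γ ⊨ φ₁ ∨ ⋯ ∨ φₘ` modulo the theory `SLat ∪ Mon_F ∪ K`: in every (non-empty) model of the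
theory, under every interpretation of the constants that makes all atoms of `Γ` true, some atom
of `Δ = [φ₁, …, φₘ]` is true. -/
def EntailsDisj (K : Set (OpClause F)) (Γ Δ : List (GAtom F C)) : Prop :=
  ∀ (S : Type (max u v)) [SemilatticeInf S] [Nonempty S] (op : F → S → S) (val : C → S),
    IsModel K op → (∀ φ ∈ Γ, φ.Holds op val) → ∃ φ ∈ Δ, φ.Holds op val

/-- `Γ ⊨ φ` modulo the theory `SLat ∪ Mon_F ∪ K`. -/
def Entails (K : Set (OpClause F)) (Γ : List (GAtom F C)) (φ : GAtom F C) : Prop :=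
  ∀ (S : Type (max u v)) [SemilatticeInf S] [Nonempty S] (op : F → S → S) (val : C → S),
    IsModel K op → (∀ ψ ∈ Γ, ψ.Holds op val) → φ.Holds op val

/-! ### Convexity, sharing and interpolation -/

variable (C) in
/-- The theory `SLat ∪ Mon_F ∪ K` is convex with respect to `≤`. -/
def IsLEConvex (K : Set (OpClause F)) : Prop :=
  ∀ (Γ : List (GAtom F C)) (D : List (GTerm F C × GTerm F C)),
    EntailsDisj K Γ (D.map fun p => GAtom.le p.1 p.2) →
      ∃ p ∈ D, Entails K Γ (GAtom.le p.1 p.2)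

/-- `f ∼ g` iff `f` and `g` both occur in a common clause of `K`. -/
def CoOccur (K : Set (OpClause F)) (f g : F) : Prop :=
  ∃ κ ∈ K, f ∈ κ.funs ∧ g ∈ κ.funs

/-- The closure operator `Θ_K`: all function symbols that are equivalent to a member of `X` under
the equivalence relation generated by co-occurrence in a clause of `K`. -/
def Theta (K : Set (OpClause F)) (X : Set F) : Set F :=
  {g | ∃ f ∈ X, Relation.EqvGen (CoOccur K) f g}

variable (C) in
/-- The theory `SLat ∪ Mon_F ∪ K` is `≤`-interpolating (with constants from `C`), where the
shared uninterpreted function symbols of `A` and `B` are those in `Θ(Σ_A) ∩ Θ(Σ_B)`. -/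
def IsLEInterpolating (K : Set (OpClause F)) (Θ : Set F → Set F) : Prop :=
  IsLEConvex C K ∧
  ∀ (A B : List (GAtom F C)) (a b : C), a ∈ conjConsts A → b ∈ conjConsts B →
    Entails K (A ++ B) (GAtom.le (GTerm.const a) (GTerm.const b)) →
    ∃ t : GTerm F C,
      t.consts ⊆ conjConsts A ∩ conjConsts B ∧
      t.funs ⊆ Θ (conjFuns A) ∩ Θ (conjFuns B) ∧
      Entails K (A ++ B) (GAtom.le (GTerm.const a) t) ∧
      Entails K (A ++ B) (GAtom.le t (GTerm.const b))

end SLO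

/-! Take two languages: the constants of `A` with the symbols in `Theta K (conjFuns A)`, and
likewise for `B`. Call an inequality pure if both sides lie in one language and `A ∧ B` entails it.
The bifilters, closed under pure consequence and under meets inside each language, form a
semilattice under reverse inclusion. It is a model in which each term of either language denotes the
bifilter it generates (`Bifilter.isModel`, `Bifilter.eval_eq_principal`). Hence `A ∧ B` holds there,
and `a ≤ b` forces `b` into the bifilter generated by `a`. That bifilter is reached in two pure
steps (`isBifilter_above`), so passing from one language to the other yields a term of both: the
interpolant (`exists_shared_of_mem_above`). If both languages contain all terms, the same model
satisfies exactly the entailed inequalities, which gives convexity. -/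

namespace SLO

section Entailment

variable {F : Type u} {C : Type v} {K : Set (OpClause F)} {Γ : List (GAtom F C)}
  {s t r : GTerm F C}

theorem Entails.le_refl (t : GTerm F C) : Entails K Γ (.le t t) :=
  fun _ _ _ _ _ _ _ => _root_.le_refl _

theorem Entails.le_trans (h₁ : Entails K Γ (.le s t)) (h₂ : Entails K Γ (.le t r)) :
    Entails K Γ (.le s r) :=
  fun S _ _ op val hM hΓ =>
    _root_.le_trans (b := t.eval op val) (h₁ S op val hM hΓ) (h₂ S op val hM hΓ)

theorem Entails.le_meet (h₁ : Entails K Γ (.le r s)) (h₂ : Entails K Γ (.le r t)) :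
    Entails K Γ (.le r (.meet s t)) :=
  fun S _ _ op val hM hΓ => le_inf (h₁ S op val hM hΓ) (h₂ S op val hM hΓ)

theorem Entails.meet_le_left (s t : GTerm F C) : Entails K Γ (.le (.meet s t) s) :=
  fun _ _ _ _ _ _ _ => inf_le_left

theorem Entails.meet_le_right (s t : GTerm F C) : Entails K Γ (.le (.meet s t) t) :=
  fun _ _ _ _ _ _ _ => inf_le_right

theorem Entails.app_mono (f : F) (h : Entails K Γ (.le s t)) :
    Entails K Γ (.le (.app f s) (.app f t)) :=
  fun S _ _ op val hM hΓ => hM.1 f (h S op val hM hΓ)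

theorem Entails.app_le_of_incl {f g : F} (h : .incl f g ∈ K) (t : GTerm F C) :
    Entails K Γ (.le (.app f t) (.app g t)) :=
  fun _ _ _ _ _ hM _ => hM.2 _ h _

theorem Entails.app_app_le_of_comp {f g k : F} (h : .comp f g k ∈ K) (t : GTerm F C) :
    Entails K Γ (.le (.app f (.app g t)) (.app k t)) :=
  fun _ _ _ _ _ hM _ => hM.2 _ h _ _ (_root_.le_refl _)

theorem Entails.of_mem {φ : GAtom F C} (h : φ ∈ Γ) : Entails K Γ φ :=
  fun _ _ _ _ _ _ hΓ => hΓ φ h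

theorem Entails.le_of_eq (h : Entails K Γ (.eq s t)) : Entails K Γ (.le s t) :=
  fun S _ _ op val hM hΓ => _root_.le_of_eq (h S op val hM hΓ)

theorem Entails.ge_of_eq (h : Entails K Γ (.eq s t)) : Entails K Γ (.le t s) :=
  fun S _ _ op val hM hΓ => _root_.ge_of_eq (h S op val hM hΓ)

end Entailment

/-- The ground terms with constants in `cs` and function symbols in `fs`. -/
def termsOver {F : Type u} {C : Type v} (cs : Set C) (fs : Set F) : Set (GTerm F C) :=
  {t | t.consts ⊆ cs ∧ t.funs ⊆ fs}

section TermsOver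

variable {F : Type u} {C : Type v} {cs : Set C} {fs : Set F} {s t : GTerm F C}

theorem const_mem_termsOver {c : C} : .const c ∈ termsOver cs fs ↔ c ∈ cs := by
  simp [termsOver, GTerm.consts, GTerm.funs]

theorem app_mem_termsOver {f : F} :
    .app f t ∈ termsOver cs fs ↔ f ∈ fs ∧ t ∈ termsOver cs fs := by
  simp only [termsOver, GTerm.consts, GTerm.funs, Set.mem_ofPred_eq, Set.union_subset_iff,
    Set.singleton_subset_iff]
  tauto

theorem meet_mem_termsOver :
    .meet s t ∈ termsOver cs fs ↔ s ∈ termsOver cs fs ∧ t ∈ termsOver cs fs := by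
  simp only [termsOver, GTerm.consts, GTerm.funs, Set.mem_ofPred_eq, Set.union_subset_iff]
  tauto

end TermsOver

/-! ### The semilattice of bifilters and its operators -/

section FilterModel

variable {F : Type u} {C : Type v} (K : Set (OpClause F)) (Γ : List (GAtom F C))
  (cs : Bool → Set C) (fs : Bool → Set F)

/-- Entailed inequality between two terms of a common language. -/
def PureLe (s t : GTerm F C) : Prop :=
  ∃ i, s ∈ termsOver (cs i) (fs i) ∧ t ∈ termsOver (cs i) (fs i) ∧ Entails K Γ (.le s t)

/-- Sets of terms that are filters with respect to each of the two languages. -/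
structure IsBifilter (U : Set (GTerm F C)) : Prop where
  up : ∀ {s t}, PureLe K Γ cs fs s t → s ∈ U → t ∈ U
  meet : ∀ {i s t}, s ∈ termsOver (cs i) (fs i) → t ∈ termsOver (cs i) (fs i) →
    s ∈ U → t ∈ U → .meet s t ∈ U

/-- The bifilter generated by a set of terms. -/
def bifilterClosure (X : Set (GTerm F C)) : Set (GTerm F C) :=
  {t | ∀ U, IsBifilter K Γ cs fs U → X ⊆ U → t ∈ U}

theorem subset_bifilterClosure (X : Set (GTerm F C)) :
    X ⊆ bifilterClosure K Γ cs fs X :=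
  fun _ ht _ _ hX => hX ht

variable {K Γ cs fs}

theorem bifilterClosure_subset {X U : Set (GTerm F C)} (hU : IsBifilter K Γ cs fs U)
    (hX : X ⊆ U) : bifilterClosure K Γ cs fs X ⊆ U :=
  fun _ ht => ht U hU hX

variable (K Γ cs fs)

theorem isBifilter_bifilterClosure (X : Set (GTerm F C)) :
    IsBifilter K Γ cs fs (bifilterClosure K Γ cs fs X) where
  up h hs U hU hX := hU.up h (hs U hU hX)
  meet hs ht hsX htX U hU hX := hU.meet hs ht (hsX U hU hX) (htX U hU hX)

/-- The bifilters, to be ordered by reverse inclusion. -/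
@[ext]
structure Bifilter : Type (max u v) where
  carrier : Set (GTerm F C)
  isBifilter : IsBifilter K Γ cs fs carrier

/-- The bifilter generated by a set of terms, as a bundled bifilter. -/
def Bifilter.gen (X : Set (GTerm F C)) : Bifilter K Γ cs fs :=
  ⟨bifilterClosure K Γ cs fs X, isBifilter_bifilterClosure K Γ cs fs X⟩

instance Bifilter.instSemilatticeInf : SemilatticeInf (Bifilter K Γ cs fs) where
  le U V := V.carrier ⊆ U.carrier
  le_refl _ := Set.Subset.rfl
  le_trans _ _ _ h₁ h₂ := Set.Subset.trans h₂ h₁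
  le_antisymm _ _ h₁ h₂ := Bifilter.ext (Set.Subset.antisymm h₂ h₁)
  inf U V := Bifilter.gen K Γ cs fs (U.carrier ∪ V.carrier)
  inf_le_left _ _ := Set.subset_union_left.trans (subset_bifilterClosure K Γ cs fs _)
  inf_le_right _ _ := Set.subset_union_right.trans (subset_bifilterClosure K Γ cs fs _)
  le_inf U _ _ h₁ h₂ := bifilterClosure_subset U.isBifilter (Set.union_subset h₁ h₂)

variable {K Γ cs fs}

theorem Bifilter.le_gen_iff {U : Bifilter K Γ cs fs} {X : Set (GTerm F C)} :
    U ≤ Bifilter.gen K Γ cs fs X ↔ X ⊆ U.carrier :=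
  ⟨fun h => (subset_bifilterClosure K Γ cs fs X).trans h,
    fun h => bifilterClosure_subset U.isBifilter h⟩

theorem Bifilter.subset_gen (X : Set (GTerm F C)) :
    X ⊆ (Bifilter.gen K Γ cs fs X).carrier :=
  subset_bifilterClosure K Γ cs fs X

/-- The interpretation of the function symbols on bifilters. -/
def Bifilter.op (f : F) (U : Bifilter K Γ cs fs) : Bifilter K Γ cs fs :=
  Bifilter.gen K Γ cs fs
    {t | ∃ i, f ∈ fs i ∧ ∃ s ∈ U.carrier, s ∈ termsOver (cs i) (fs i) ∧ t = .app f s}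

theorem Bifilter.app_mem_op {U : Bifilter K Γ cs fs} {f : F} {i : Bool} {s : GTerm F C}
    (hf : f ∈ fs i) (hs : s ∈ U.carrier) (hsi : s ∈ termsOver (cs i) (fs i)) :
    .app f s ∈ (U.op f).carrier :=
  Bifilter.subset_gen _ ⟨i, hf, s, hs, hsi, rfl⟩

/-- By `hK` each language contains all or none of the symbols of a clause. So at any generator the
clause yields a pure inequality, and bifilters are closed under those. -/
theorem Bifilter.isModel
    (hK : ∀ i, ∀ κ ∈ K, ∀ f ∈ κ.funs, ∀ g ∈ κ.funs, f ∈ fs i → g ∈ fs i) :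
    IsModel K (Bifilter.op : F → Bifilter K Γ cs fs → Bifilter K Γ cs fs) := by
  refine ⟨fun f U V h => ?_, ?_⟩
  · refine Bifilter.le_gen_iff.2 ?_
    rintro _ ⟨i, hf, s, hs, hsi, rfl⟩
    exact Bifilter.app_mem_op hf (h hs) hsi
  · rintro (⟨f, g⟩ | ⟨f, g, k⟩) hκ
    · intro U
      refine Bifilter.le_gen_iff.2 ?_
      rintro _ ⟨i, hg, s, hs, hsi, rfl⟩
      have hf : f ∈ fs i := hK i _ hκ g (by simp [OpClause.funs]) f (by simp [OpClause.funs]) hg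
      exact (U.op f).isBifilter.up
        ⟨i, app_mem_termsOver.2 ⟨hf, hsi⟩, app_mem_termsOver.2 ⟨hg, hsi⟩, .app_le_of_incl hκ s⟩
        (Bifilter.app_mem_op hf hs hsi)
    · intro U V hVU
      refine Bifilter.le_gen_iff.2 ?_
      rintro _ ⟨i, hk, s, hs, hsi, rfl⟩
      have hf : f ∈ fs i := hK i _ hκ k (by simp [OpClause.funs]) f (by simp [OpClause.funs]) hk
      have hg : g ∈ fs i := hK i _ hκ k (by simp [OpClause.funs]) g (by simp [OpClause.funs]) hk
      have hgs : .app g s ∈ termsOver (cs i) (fs i) := app_mem_termsOver.2 ⟨hg, hsi⟩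
      exact (V.op f).isBifilter.up
        ⟨i, app_mem_termsOver.2 ⟨hf, hgs⟩, app_mem_termsOver.2 ⟨hk, hsi⟩,
          .app_app_le_of_comp hκ s⟩
        -- The hypothesis `V ≤ op g U` puts the term `g s` into `V`, so `f (g s)` generates `op f
        -- V`; it lies purely below `k s`.
        (Bifilter.app_mem_op hf (hVU (Bifilter.app_mem_op hg hs hsi)) hgs)

/-! ### Principal bifilters and passage between the languages -/

variable (K Γ cs fs)

/-- The terms reached from `s` by at most two steps of `PureLe`. -/
def above (s : GTerm F C) : Set (GTerm F C) :=
  {t | ∃ w, PureLe K Γ cs fs s w ∧ PureLe K Γ cs fs w t}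

variable {K Γ cs fs}

theorem PureLe.entails {s t : GTerm F C} (h : PureLe K Γ cs fs s t) : Entails K Γ (.le s t) :=
  let ⟨_, _, _, h⟩ := h; h

theorem entails_of_mem_above {s t : GTerm F C} (h : t ∈ above K Γ cs fs s) :
    Entails K Γ (.le s t) :=
  let ⟨_, h₁, h₂⟩ := h; h₁.entails.le_trans h₂.entails

theorem mem_above_of_pureLe {s t : GTerm F C} (h : PureLe K Γ cs fs s t) :
    t ∈ above K Γ cs fs s :=
  let ⟨i, _, ht, _⟩ := h; ⟨t, h, i, ht, ht, .le_refl t⟩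

/-- A term above `s` in a language that does not contain `s` is reached through a term of
both languages. -/
theorem exists_shared_of_mem_above {s t : GTerm F C} {i : Bool}
    (hs : s ∉ termsOver (cs i) (fs i)) (ht : t ∈ termsOver (cs i) (fs i))
    (h : t ∈ above K Γ cs fs s) :
    ∃ w, (∀ j, w ∈ termsOver (cs j) (fs j)) ∧
      Entails K Γ (.le s w) ∧ Entails K Γ (.le w t) := by
  obtain ⟨w, ⟨j, hsj, hwj, hsw⟩, ⟨k, hwk, htk, hwt⟩⟩ := h
  have hji : j = !i := by
    cases i <;> cases j <;> simp_all
  subst hji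
  -- The first step stays in the other language. If the second step is in language `i`, the midpoint
  -- is shared; otherwise the endpoint `t` is.
  by_cases hk : k = i
  · subst hk
    refine ⟨w, fun j => ?_, hsw, hwt⟩
    cases k <;> cases j <;> assumption
  · have hki : k = !i := by cases i <;> cases k <;> simp_all
    subst hki
    refine ⟨t, fun j => ?_, hsw.le_trans hwt, .le_refl t⟩
    cases i <;> cases j <;> assumption

/-- Two steps suffice: a chain returning to a language of `s` collapses to one step, because purity
restricts only the two sides and not the derivation. In a language without `s`, everything factors
through shared terms, which are closed under meets. -/
theorem isBifilter_above (s : GTerm F C) : IsBifilter K Γ cs fs (above K Γ cs fs s) where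
  up {t r} := by
    rintro ⟨i, hti, hri, htr⟩ ht
    by_cases hs : s ∈ termsOver (cs i) (fs i)
    · exact mem_above_of_pureLe ⟨i, hs, hri, (entails_of_mem_above ht).le_trans htr⟩
    · obtain ⟨w, hw, hsw, hwt⟩ := exists_shared_of_mem_above hs hti ht
      obtain ⟨_, ⟨j, hsj, _⟩, _⟩ := ht
      exact ⟨w, ⟨j, hsj, hw j, hsw⟩, i, hw i, hri, hwt.le_trans htr⟩
  meet {i t r} hti hri ht hr := by
    by_cases hs : s ∈ termsOver (cs i) (fs i)
    · exact mem_above_of_pureLe ⟨i, hs, meet_mem_termsOver.2 ⟨hti, hri⟩,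
        (entails_of_mem_above ht).le_meet (entails_of_mem_above hr)⟩
    · obtain ⟨w, hw, hsw, hwt⟩ := exists_shared_of_mem_above hs hti ht
      obtain ⟨w', hw', hsw', hwr⟩ := exists_shared_of_mem_above hs hri hr
      obtain ⟨_, ⟨j, hsj, _⟩, _⟩ := ht
      exact ⟨.meet w w',
        ⟨j, hsj, meet_mem_termsOver.2 ⟨hw j, hw' j⟩, hsw.le_meet hsw'⟩,
        i, meet_mem_termsOver.2 ⟨hw i, hw' i⟩, meet_mem_termsOver.2 ⟨hti, hri⟩,
        ((Entails.meet_le_left w w').le_trans hwt).le_meet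
          ((Entails.meet_le_right w w').le_trans hwr)⟩

variable (K Γ cs fs)

/-- The bifilter of the terms above a given term. -/
def Bifilter.principal (s : GTerm F C) : Bifilter K Γ cs fs :=
  ⟨above K Γ cs fs s, isBifilter_above s⟩

variable {K Γ cs fs}

theorem self_mem_above {s : GTerm F C} {i : Bool} (hs : s ∈ termsOver (cs i) (fs i)) :
    s ∈ above K Γ cs fs s :=
  mem_above_of_pureLe ⟨i, hs, hs, .le_refl s⟩

theorem Bifilter.le_principal {U : Bifilter K Γ cs fs} {s : GTerm F C} (h : s ∈ U.carrier) :
    U ≤ Bifilter.principal K Γ cs fs s :=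
  fun _ ⟨_, h₁, h₂⟩ => U.isBifilter.up h₂ (U.isBifilter.up h₁ h)

/-- When the languages differ, a shared `w` between `s` and `t` makes `f w` shared too, as `f` is in
both. -/
theorem app_mem_above {f : F} {i j : Bool} {s t : GTerm F C}
    (hfi : f ∈ fs i) (hfj : f ∈ fs j)
    (hs : s ∈ termsOver (cs i) (fs i)) (ht : t ∈ termsOver (cs j) (fs j))
    (h : t ∈ above K Γ cs fs s) : .app f t ∈ above K Γ cs fs (.app f s) := by
  by_cases hsj : s ∈ termsOver (cs j) (fs j)
  · exact mem_above_of_pureLe ⟨j, app_mem_termsOver.2 ⟨hfj, hsj⟩, app_mem_termsOver.2 ⟨hfj, ht⟩,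
      (entails_of_mem_above h).app_mono f⟩
  · obtain ⟨w, hw, hsw, hwt⟩ := exists_shared_of_mem_above hsj ht h
    exact ⟨.app f w,
      ⟨i, app_mem_termsOver.2 ⟨hfi, hs⟩, app_mem_termsOver.2 ⟨hfi, hw i⟩, hsw.app_mono f⟩,
      j, app_mem_termsOver.2 ⟨hfj, hw j⟩, app_mem_termsOver.2 ⟨hfj, ht⟩, hwt.app_mono f⟩

/-- The delicate case is application: `op f` also has generators `f t` with `t` from the other
language, and `app_mem_above` shows that they add nothing. -/
theorem Bifilter.eval_eq_principal {i : Bool} :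
    ∀ {t : GTerm F C}, t ∈ termsOver (cs i) (fs i) →
      t.eval Bifilter.op (fun c => Bifilter.principal K Γ cs fs (.const c)) =
        Bifilter.principal K Γ cs fs t
  | .const _, _ => rfl
  | .app f s, h => by
    obtain ⟨hf, hs⟩ := app_mem_termsOver.1 h
    rw [GTerm.eval, Bifilter.eval_eq_principal hs]
    refine le_antisymm
      (Bifilter.le_principal (Bifilter.app_mem_op hf (self_mem_above hs) hs))
      (Bifilter.le_gen_iff.2 ?_)
    rintro _ ⟨j, hfj, t, ht, htj, rfl⟩
    exact app_mem_above hf hfj hs htj ht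
  | .meet s t, h => by
    obtain ⟨hs, ht⟩ := meet_mem_termsOver.1 h
    rw [GTerm.eval, Bifilter.eval_eq_principal hs, Bifilter.eval_eq_principal ht]
    refine le_antisymm (Bifilter.le_principal ?_) (le_inf ?_ ?_)
    · refine (Bifilter.isBifilter _).meet hs ht ?_ ?_
      · exact (inf_le_left : Bifilter.principal K Γ cs fs s ⊓ _ ≤ _) (self_mem_above hs)
      · exact (inf_le_right : _ ⊓ Bifilter.principal K Γ cs fs t ≤ _) (self_mem_above ht)
    · exact Bifilter.le_principal (mem_above_of_pureLe ⟨i, h, hs, .meet_le_left s t⟩)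
    · exact Bifilter.le_principal (mem_above_of_pureLe ⟨i, h, ht, .meet_le_right s t⟩)

theorem Bifilter.holds_le_iff {i j : Bool} {s t : GTerm F C}
    (hs : s ∈ termsOver (cs i) (fs i)) (ht : t ∈ termsOver (cs j) (fs j)) :
    (GAtom.le s t).Holds Bifilter.op (fun c => Bifilter.principal K Γ cs fs (.const c)) ↔
      t ∈ above K Γ cs fs s := by
  rw [GAtom.Holds, Bifilter.eval_eq_principal hs, Bifilter.eval_eq_principal ht]
  exact ⟨fun h => h (self_mem_above ht), fun h => Bifilter.le_principal h⟩

theorem Bifilter.holds_of_mem {φ : GAtom F C} {i : Bool} (hφ : φ ∈ Γ)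
    (hc : φ.consts ⊆ cs i) (hf : φ.funs ⊆ fs i) :
    φ.Holds Bifilter.op (fun c => Bifilter.principal K Γ cs fs (.const c)) := by
  have hent : Entails K Γ φ := .of_mem hφ
  rcases φ with ⟨s, t⟩ | ⟨s, t⟩ <;>
    obtain ⟨hcs, hct⟩ := Set.union_subset_iff.1 hc <;>
    obtain ⟨hfs, hft⟩ := Set.union_subset_iff.1 hf
  · exact (Bifilter.holds_le_iff (i := i) (j := i) ⟨hcs, hfs⟩ ⟨hct, hft⟩).2
      (mem_above_of_pureLe ⟨i, ⟨hcs, hfs⟩, ⟨hct, hft⟩, hent⟩)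
  · exact le_antisymm
      ((Bifilter.holds_le_iff (i := i) (j := i) ⟨hcs, hfs⟩ ⟨hct, hft⟩).2
        (mem_above_of_pureLe ⟨i, ⟨hcs, hfs⟩, ⟨hct, hft⟩, hent.le_of_eq⟩))
      ((Bifilter.holds_le_iff (i := i) (j := i) ⟨hct, hft⟩ ⟨hcs, hfs⟩).2
        (mem_above_of_pureLe ⟨i, ⟨hct, hft⟩, ⟨hcs, hfs⟩, hent.ge_of_eq⟩))

end FilterModel

/-! ### Convexity and interpolation -/

theorem subset_Theta {F : Type u} (K : Set (OpClause F)) (X : Set F) : X ⊆ Theta K X :=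
  fun f hf => ⟨f, hf, .refl f⟩

theorem mem_Theta_of_mem_clause {F : Type u} {K : Set (OpClause F)} {X : Set F}
    {κ : OpClause F} (hκ : κ ∈ K) {f g : F} (hf : f ∈ κ.funs) (hg : g ∈ κ.funs)
    (h : f ∈ Theta K X) : g ∈ Theta K X :=
  let ⟨e, he, hef⟩ := h
  ⟨e, he, .trans _ _ _ hef (.rel _ _ ⟨κ, hκ, hf, hg⟩)⟩

theorem isLEConvex {F : Type u} (C : Type v) (K : Set (OpClause F)) : IsLEConvex C K := by
  intro Γ D h
  -- With both languages full, this single model refutes every inequality that is not entailed.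
  let cs : Bool → Set C := fun _ => Set.univ
  let fs : Bool → Set F := fun _ => Set.univ
  have hmem (t : GTerm F C) : t ∈ termsOver (cs true) (fs true) :=
    ⟨Set.subset_univ _, Set.subset_univ _⟩
  obtain ⟨φ, hφ, hH⟩ := @h (Bifilter K Γ cs fs) _ ⟨Bifilter.gen K Γ cs fs ∅⟩ Bifilter.op
    (fun c => Bifilter.principal K Γ cs fs (.const c))
    (Bifilter.isModel fun _ _ _ _ _ _ _ _ => Set.mem_univ _)
    (fun φ hφ => Bifilter.holds_of_mem (i := true) hφ (Set.subset_univ _) (Set.subset_univ _))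
  obtain ⟨p, hp, rfl⟩ := List.mem_map.1 hφ
  exact ⟨p, hp, entails_of_mem_above ((Bifilter.holds_le_iff (i := true) (j := true)
    (hmem _) (hmem _)).1 hH)⟩

theorem exists_interpolant {F : Type u} {C : Type v} {K : Set (OpClause F)}
    {A B : List (GAtom F C)} {a b : C} (ha : a ∈ conjConsts A) (hb : b ∈ conjConsts B)
    (h : Entails K (A ++ B) (.le (.const a) (.const b))) :
    ∃ t : GTerm F C,
      t.consts ⊆ conjConsts A ∩ conjConsts B ∧
      t.funs ⊆ Theta K (conjFuns A) ∩ Theta K (conjFuns B) ∧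
      Entails K (A ++ B) (.le (.const a) t) ∧ Entails K (A ++ B) (.le t (.const b)) := by
  let cs : Bool → Set C := fun i => conjConsts (cond i A B)
  let fs : Bool → Set F := fun i => Theta K (conjFuns (cond i A B))
  have hH := @h (Bifilter K (A ++ B) cs fs) _ ⟨Bifilter.gen K (A ++ B) cs fs ∅⟩ Bifilter.op
    (fun c => Bifilter.principal K (A ++ B) cs fs (.const c))
    (Bifilter.isModel fun _ _ hκ _ hf _ hg => mem_Theta_of_mem_clause hκ hf hg)
    (fun φ hφ => by
      obtain ⟨i, hi⟩ : ∃ i, φ ∈ cond i A B :=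
        (List.mem_append.1 hφ).elim (fun h => ⟨true, h⟩) (fun h => ⟨false, h⟩)
      exact Bifilter.holds_of_mem (i := i) hφ (fun c hc => ⟨φ, hi, hc⟩)
        (fun f hf => subset_Theta K _ ⟨φ, hi, hf⟩))
  have ha' : .const a ∈ termsOver (cs true) (fs true) := const_mem_termsOver.2 ha
  have hb' : .const b ∈ termsOver (cs false) (fs false) := const_mem_termsOver.2 hb
  obtain ⟨w, hw, haw, hwb⟩ : ∃ w, (∀ j, w ∈ termsOver (cs j) (fs j)) ∧
      Entails K (A ++ B) (.le (.const a) w) ∧ Entails K (A ++ B) (.le w (.const b)) := by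
    by_cases haB : .const a ∈ termsOver (cs false) (fs false)
    -- If `a` also occurs in `B`, it is its own interpolant.
    · exact ⟨.const a, fun j => by cases j <;> assumption, .le_refl _, h⟩
    · exact exists_shared_of_mem_above haB hb' ((Bifilter.holds_le_iff ha' hb').1 hH)
  exact ⟨w, Set.subset_inter (hw true).1 (hw false).1,
    Set.subset_inter (hw true).2 (hw false).2, haw, hwb⟩

end SLO

theorem mainTheorem2 {F : Type u} (C : Type v) (K : Set (SLO.OpClause F)) :
    SLO.IsLEInterpolating C K (SLO.Theta K) :=
  ⟨SLO.isLEConvex C K, fun _ _ _ _ ha hb h => SLO.exists_interpolant ha hb h⟩
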